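/- **Setting (CFL: convex function chasing with a long-term constraint).** Let $d\ge 1$, let $\mathbf c\in\mathbb R^d$ have positive entries, let $\mathbf w\in\mathbb R^d$ have non-negative entries, put $\|\mathbf x\|_{\ell_1(\mathbf a)}=\sum_i \mathbf a^i|\mathbf x^i|$, $c(\mathbf x)=\|\mathbf x\|_{\ell_1(\mathbf c)}$ and $X=\{\mathbf x\in[0,1]^d : c(\mathbf x)\le 1\}$. Let $0<L\le U$ and assume that $\beta:=\max_i \mathbf w^i/\mathbf c^i$ lies in $[0,\frac{U-L}{2})$. A CFL instance consists of a horizon $T$ and convex differentiable costs $f_1,\dots,f_T$ on $X$ with $f_t(\mathbf 0)=0$ and $L\le[\nabla f_t]^i/\mathbf c^i\le U$ for all $i$, such that the problem $$\min\ \sum_{t=1}^T f_t(\mathbf x_t)+\sum_{t=1}^{T+1}\|\mathbf x_t-\mathbf x_{t-1}\|_{\ell_1(\mathbf w)}\quad\text{s.t. } \mathbf x_t\in X\ (1\le t\le T),\ \ \mathbf x_0=\mathbf x_{T+1}=\mathbf 0,\ \ \sum_{t=1}^T c(\mathbf x_t)\ge 1$$ is feasible; $\mathrm{OPT}(\mathcal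 I)$ denotes its optimal value. A deterministic online algorithm $\mathrm{ALG}$ chooses $\mathbf x_t$ as a function of $T$ and $f_1,\dots,f_t$ only (it may depend on $d,\mathbf c,\mathbf w,L,U$), and its decisions are feasible on every instance; $\mathrm{ALG}(\mathcal I)$ is its cost. Its competitive ratio on a set $\mathcal F$ of instances is $\sup_{\mathcal I\in\mathcal F}\mathrm{ALG}(\mathcal I)/\mathrm{OPT}(\mathcal I)$. Finally let $$\alpha=\Big[W\Big(\Big(\tfrac{2\beta}{U}+\tfrac LU-1\Big)e^{\frac{2\beta}{U}-1}\Big)-\tfrac{2\beta}{U}+1\Big]^{-1},$$ where $W$ is the principal branch of the Lambert $W$ function. **The family.** Let $k$ be an index with $\mathbf w^k/\mathbf c^k=\beta$. For $n\ge1$ and $\delta=(U-L)/n$ let $\mathbf{Up}(\mathbf x)=\sum_i U\mathbf c^i\mathbf x^i$ and $\mathbf{Down}^i(\mathbf x)=\sum_{j\ne k}U\mathbf c^j\mathbf x^j+(U-i\delta)\mathbf c^k\mathbf x^k$ for $1\le i\le n$. A $y$-sequence with $y=U-j\delta$, $0\le j\le n$, and batch length $m$ is a sequence of cost functions, each of which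 is $\mathbf{Up}$ or some $\mathbf{Down}^i$ with $1\le i\le j$, in which the indices of the $\mathbf{Down}$ costs are non-decreasing in time (decreasing costs), interrupted by $\mathbf{Up}$ costs at arbitrary times, and which ends with $m$ consecutive copies of $\mathbf{Down}^j$ followed by at least $m$ copies of $\mathbf{Up}$ and nothing else (for $j=0$ the whole sequence consists of $\mathbf{Up}$). For $N\ge0$ let $\mathcal F_N$ be the family of all $y$-sequences with $n>N$, $m>N$, $0\le j\le n$, and with a horizon $T$ such that for every $j'\in\{0,\dots,N\}$ there is an $i$ with $(T-(j'+1))\,\mathbf c^i\ge 1$ (the horizon is long compared with the time needed to meet the constraint). **Theorem 3.4.** For every $N$, all members of $\mathcal F_N$ are CFL instances, and every deterministic online algorithm for CFL has competitive ratio at least $\alpha$ on $\mathcal F_N$: $$\sup_{\mathcal I\in\mathcal F_N}\frac{\mathrm{ALG}(\mathcal I)}{\mathrm{OPT}(\mathcal I)}\ \ge\ \alpha .$$ -/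

import Mathlib

open scoped BigOperators

noncomputable section

namespace CFL

/-- Decisions (points of `ℝ^d`). -/
abbrev Vec (d : ℕ) : Type := Fin d → ℝ

/-- Hitting cost functions. -/
abbrev Cost (d : ℕ) : Type := Vec d → ℝ

/-- The weighted `ℓ₁` norm with weight vector `a`. -/
def wl1 {d : ℕ} (a x : Vec d) : ℝ := ∑ i, a i * |x i|

/-- The fixed data of the problem, known to every algorithm: the dimension `d ≥ 1`, the weights `c`
of the long-term constraint, the weights `w` of the switching cost, and the gradient bounds
`L`, `U`; the normalized switching coefficient `β = maxᵢ wⁱ / cⁱ` lies in `[0, (U - L) / 2)`. -/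
structure Setting (d : ℕ) where
  c : Vec d
  w : Vec d
  L : ℝ
  U : ℝ
  d_pos : 0 < d
  c_pos : ∀ i, 0 < c i
  w_nonneg : ∀ i, 0 ≤ w i
  L_pos : 0 < L
  beta_lt : (⨆ i, w i / c i) < (U - L) / 2

/-- An input sequence: a horizon `T` and the cost functions `f 1, …, f T`
(values of `f` outside `1, …, T` are never used). -/
structure Input (d : ℕ) where
  T : ℕ
  f : ℕ → Cost d

namespace Setting

variable {d : ℕ} (S : Setting d)

/-- `β = maxᵢ wⁱ / cⁱ`. -/
def beta : ℝ := ⨆ i, S.w i / S.c i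

/-- The decision space: `xⁱ ∈ [0, 1]` for all `i`, and `c(x) ≤ 1`. -/
def X : Set (Vec d) := {x | (∀ i, 0 ≤ x i ∧ x i ≤ 1) ∧ wl1 S.c x ≤ 1}

/-- Admissible hitting costs: convex on `X`, zero at the origin, differentiable on `X` with
`L ≤ [∇f]ⁱ / cⁱ ≤ U` in every direction `i`. -/
def IsCost (f : Cost d) : Prop :=
  ConvexOn ℝ S.X f ∧ f 0 = 0 ∧
    ∀ x ∈ S.X, ∃ f' : Vec d →L[ℝ] ℝ, HasFDerivWithinAt f f' S.X x ∧
      ∀ i, S.L ≤ f' (Pi.single i 1) / S.c i ∧ f' (Pi.single i 1) / S.c i ≤ S.U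

/-- Feasible solutions for horizon `T`: start and end at the origin, stay in `X`, and satisfy the
long-term constraint. -/
def IsFeasible (T : ℕ) (x : ℕ → Vec d) : Prop :=
  x 0 = 0 ∧ x (T + 1) = 0 ∧ (∀ t ∈ Finset.Icc 1 T, x t ∈ S.X) ∧
    1 ≤ ∑ t ∈ Finset.Icc 1 T, wl1 S.c (x t)

/-- Total hitting cost plus total switching cost of a decision sequence. -/
def totalCost (I : Input d) (x : ℕ → Vec d) : ℝ :=
  ∑ t ∈ Finset.Icc 1 I.T, I.f t (x t) +
    ∑ t ∈ Finset.Icc 1 (I.T + 1), wl1 S.w (x t - x (t - 1))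

/-- The set `Ω` of valid instances: all cost functions are admissible and the long-term constraint
can be met within the horizon. -/
def instances : Set (Input d) :=
  {I | (∀ t ∈ Finset.Icc 1 I.T, S.IsCost (I.f t)) ∧ ∃ x, S.IsFeasible I.T x}

/-- The offline optimal cost. -/
def opt (I : Input d) : ℝ := sInf (S.totalCost I '' {x | S.IsFeasible I.T x})

end Setting

/-- A deterministic decision rule that sees the horizon `T`, the time `t`, and the cost functions
`f 1, …, f t` revealed so far, and then decides `x t`. -/
abbrev Rule (d : ℕ) : Type := ℕ → (t : ℕ) → (Fin t → Cost d) → Vec d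

/-- The decision sequence that a rule produces on an input, starting and ending at the origin. -/
def Rule.run {d : ℕ} (A : Rule d) (I : Input d) (t : ℕ) : Vec d :=
  if t ∈ Finset.Icc 1 I.T then A I.T t (fun s : Fin t => I.f (s + 1)) else 0

namespace Setting

variable {d : ℕ} (S : Setting d)

/-- A deterministic online algorithm: a rule whose decisions are feasible on every valid
instance. -/
def IsOnlineAlgorithm (A : Rule d) : Prop :=
  ∀ I ∈ S.instances, S.IsFeasible I.T (A.run I)

/-- The competitive ratio `sup ALG(I) / OPT(I)` over a set `F` of instances. -/
def compRatio (A : Rule d) (F : Set (Input d)) : EReal :=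
  ⨆ I ∈ F, ((S.totalCost I (A.run I) / S.opt I : ℝ) : EReal)

/-- The linear cost whose normalized coefficient is `U` in every direction except `k`, and
`U - i δ` with `δ = (U - L) / n` in direction `k`. This is `Down^i` for `i ≥ 1`, and `Up` for
`i = 0`. -/
def levelCost (k : Fin d) (n i : ℕ) : Cost d := fun x =>
  ∑ j, (if j = k then S.U - i * ((S.U - S.L) / n) else S.U) * S.c j * x j

/-- The input sequences of the `y`-adversary with `y = U - j δ`, where `δ = (U - L) / n`: every cost
function is `Up` or some `Down^i` with `1 ≤ i ≤ j`; the `Down` levels occur in a (weakly) increasing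
order, that is at weakly decreasing prices, and may be interrupted by `Up` at any time; at the end
come `m` consecutive copies of the cheapest cost function `Down^j`, then `Up` at least `m` times and
nothing else. For `j = 0` (`y = U`) this is a stream of `Up`. -/
def IsYSequence (k : Fin d) (n m j : ℕ) (I : Input d) : Prop :=
  ∃ (l : ℕ → ℕ) (τ : ℕ),
    (∀ t ∈ Finset.Icc 1 I.T, I.f t = S.levelCost k n (l t) ∧ l t ≤ j) ∧
    (∀ s ∈ Finset.Icc 1 I.T, ∀ t ∈ Finset.Icc 1 I.T,
      s ≤ t → l s ≠ 0 → l t ≠ 0 → l s ≤ l t) ∧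
    (∀ t ∈ Finset.Ioc τ (τ + m), l t = j) ∧
    (∀ t ∈ Finset.Ioc (τ + m) I.T, l t = 0) ∧
    τ + m + m ≤ I.T

/-- The family of all `y`-adversary sequences, `y ∈ [L, U]`, with resolution `n > N`, batch length
`m > N`, and a horizon for which the first time `j'` with `(T - (j' + 1)) cⁱ < 1` for all `i` is
later than `N`. -/
def yFamily (k : Fin d) (N : ℕ) : Set (Input d) :=
  {I | (∃ n m j : ℕ, N < n ∧ N < m ∧ j ≤ n ∧ S.IsYSequence k n m j I) ∧
    ∀ j' ≤ N, ∃ i, 1 ≤ ((I.T : ℝ) - (j' + 1)) * S.c i}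

end Setting

/-- The principal branch of the Lambert `W` function: the inverse of `v ↦ v e^v` on `[-1, ∞)`. -/
def lambertW (z : ℝ) : ℝ := Function.invFunOn (fun v : ℝ => v * Real.exp v) (Set.Ici (-1)) z

/-- `α = [W((2β/U + L/U - 1) e^{2β/U - 1}) - 2β/U + 1]⁻¹`. -/
def Setting.alpha {d : ℕ} (S : Setting d) : ℝ :=
  (lambertW ((2 * S.beta / S.U + S.L / S.U - 1) * Real.exp (2 * S.beta / S.U - 1))
    - 2 * S.beta / S.U + 1)⁻¹

end CFL

end

/-! The adversary builds one adaptive sequence that passes through ever cheaper `Down` levels. It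
may stop after any level `j` and continue with `Up`. All these cutoffs share a prefix, so causality
makes the amount `D i` bought at each `Down` level the same for every `j` beyond it. Spreading one
unit over the batch at level `j` bounds the optimum by `U - j δ + 2 β / m` (`opt_le`).

Each unit bought at a `Down` price is made to cost almost `2 β` in switching
(`exists_level_extension`). Once the decision has grown, an `Up` is inserted. Holding the position
then means buying at price `U`, and dropping it means climbing again. Each interruption accompanies
a purchase of fixed minimal size, so there are boundedly many before the total reaches `K`, and then
hitting costs alone give ratio `q`. Otherwise the cost at cutoff `j` is, up to small errors, at
least `max (U - S j) (P j)`, where a unit bought at level `i` contributes `i δ - 2 β` to the saving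
`S` and the rest of `U` to the cost `P` (`max_sub_le_totalCost`).

For `q < α` these bounds cannot all stay below `q (U - j δ) + ε` (`exists_level_max_ge`). Otherwise
`S j` must exceed `U - q (U - j δ) - ε` at every `j`. Saving at net rate `z` costs `U / z - 1` per
unit saved. Summing this dual price by parts produces a logarithm, which tends to `r = 1 / α` by the
equation defining `α`, and `P n` becomes too large. -/

namespace CFL

/-! ### The linear program behind the lower bound -/

/-- Whatever amounts `D i ≥ 0` are bought at the prices `U - (i + 1) δ` with surcharge `2 β`, at
some level `j` the cost (with the rest bought at price `U`) exceeds `q` times the best price. -/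
theorem exists_level_max_ge {U L β q r : ℝ} (hL : 0 < L) (hr0 : 0 < r) (hβ : 0 ≤ β) (hLU : 2 * β < U - L)
    (hr : U * r < U - 2 * β) (h_eq : U - 2 * β - U * r = (U - 2 * β - L) * Real.exp (-r))
    (hq : 0 < q) (hqr : q * r < 1) :
    ∃ ε > 0, ∃ n₀ : ℕ, ∀ n : ℕ, n₀ ≤ n → 0 < n → ∀ D : ℕ → ℝ, (∀ i, 0 ≤ D i) →
      ∃ j ≤ n, q * (U - j * ((U - L) / n)) + ε ≤
        max (U - ∑ i ∈ Finset.range j, ((i + 1 : ℕ) * ((U - L) / n) - 2 * β) * D i)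
          (∑ i ∈ Finset.range j, (U - ((i + 1 : ℕ) * ((U - L) / n) - 2 * β)) * D i) := by
  -- The net saving at price `U r`. In the limiting case `q = 1 / r`, no saving is demanded at
  -- higher prices.
  set κ := U - 2 * β - U * r with hκ
  have hκ0 : 0 < κ := by linarith
  have hU : 0 < U := by linarith
  have hg : 0 < L * (1 - q * r) := mul_pos hL (by linarith)
  -- This resolution pushes the discretisation error `q U (2 δ / κ)` below `ε`.
  obtain ⟨n₀, hn₀⟩ := exists_nat_gt (4 * q * U * (U - L) / (κ * (L * (1 - q * r))))
  refine ⟨L * (1 - q * r) / 2, by positivity, n₀, fun n hn hn0 D hD => ?_⟩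
  set ε := L * (1 - q * r) / 2 with hε
  set δ := (U - L) / n with hδ
  have hn0' : (0 : ℝ) < n := by exact_mod_cast hn0
  have hδ0 : 0 < δ := div_pos (by linarith) hn0'
  have hnδ : n * δ = U - L := by rw [hδ]; field_simp
  have hsmall : q * U * (2 * δ / κ) < ε := by
    have h1 : 4 * q * U * (U - L) / (κ * (L * (1 - q * r))) < n :=
      hn₀.trans_le (by exact_mod_cast hn)
    rw [div_lt_iff₀ (by positivity), ← hnδ] at h1
    have h2 : 4 * q * U * δ < κ * (L * (1 - q * r)) := by
      have : n * (4 * q * U * δ) < n * (κ * (L * (1 - q * r))) := by linarith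
      exact lt_of_mul_lt_mul_left this hn0'.le
    rw [hε, mul_div_assoc', div_lt_iff₀ hκ0]
    linarith
  by_contra! hcon
  set S : ℕ → ℝ := fun j => ∑ i ∈ Finset.range j, ((i + 1 : ℕ) * δ - 2 * β) * D i with hS
  set P : ℕ → ℝ := fun j => ∑ i ∈ Finset.range j, (U - ((i + 1 : ℕ) * δ - 2 * β)) * D i with hP
  have hSlt : ∀ j ≤ n, U - q * (U - j * δ) - ε < S j := by
    intro j hj
    have := (le_max_left _ _).trans_lt (hcon j hj)
    simp only [hS]; linarith
  have hPlt : P n < q * L + ε := by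
    have := (le_max_right _ _).trans_lt (hcon n le_rfl)
    rw [hnδ] at this
    simp only [hP]; linarith
  set z : ℕ → ℝ := fun j => j * δ - 2 * β with hz
  have hz_succ : ∀ j, z (j + 1) = z j + δ := by intro j; simp only [hz]; push_cast; ring
  have hz_mono : Monotone z := monotone_nat_of_le_succ fun j => by rw [hz_succ]; linarith
  have hzn : z n = U - L - 2 * β := by simp only [hz, hnδ]
  -- the first level whose price is at most `U r`
  set i₁ := ⌈(U - U * r) / δ⌉₊ with hi₁
  have hi₁_ge : U - U * r ≤ i₁ * δ := by
    rw [← div_le_iff₀ hδ0]; exact Nat.le_ceil _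
  have hzge : κ ≤ z i₁ := by simp only [hz]; linarith
  have hzi₁ : 0 < z i₁ := hκ0.trans_le hzge
  have hUr : 0 ≤ U - U * r := by linarith
  have hi₁_lt : i₁ * δ < U - U * r + δ := by
    have := Nat.ceil_lt_add_one (div_nonneg hUr hδ0.le)
    have h2 := mul_lt_mul_of_pos_right this hδ0
    rwa [add_mul, div_mul_cancel₀ _ hδ0.ne', one_mul] at h2
  have hrpos : L ≤ U * r := by
    have h1 : 0 < U - 2 * β - L := by linarith
    have h2 : Real.exp (-r) ≤ 1 := Real.exp_le_one_iff.2 (by linarith)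
    have h3 := mul_le_mul_of_nonneg_left h2 h1.le
    linarith
  have hi₁n : i₁ ≤ n := by
    rw [hi₁, Nat.ceil_le, div_le_iff₀ hδ0, hnδ]; linarith
  -- In `P j - (U / z j - 1) * S j` the newest purchase cancels. Consecutive values therefore differ
  -- by the drop of the dual price times `S`, which `hSlt` bounds below. The left side is that sum
  -- by parts, and the shift by `δ` keeps the logarithm below the sum of `δ / z`.
  have key : ∀ j, i₁ ≤ j → j ≤ n →
      -(U / z j - 1) * (U - q * (U - j * δ) - ε)
        + (U / z i₁ - 1) * (U - q * (U - i₁ * δ) - ε)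
        + q * U * Real.log ((z j + δ) / (z i₁ + δ)) - q * (j * δ - i₁ * δ)
      ≤ P j - (U / z j - 1) * S j := by
    intro j hj
    induction j, hj using Nat.le_induction with
    | base =>
      intro _
      rw [div_self (by linarith : z i₁ + δ ≠ 0), Real.log_one]
      -- Earlier levels save at most `z i₁` per unit, possibly a negative amount, so this dual price
      -- undercuts all of them.
      have : 0 ≤ P i₁ - (U / z i₁ - 1) * S i₁ := by
        simp only [hP, hS]
        rw [Finset.mul_sum, ← Finset.sum_sub_distrib]
        refine Finset.sum_nonneg fun i hi => ?_
        have h1 : z (i + 1) ≤ z i₁ := hz_mono (Finset.mem_range.1 hi)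
        have h2 : (U - ((i + 1 : ℕ) * δ - 2 * β)) * D i
            - (U / z i₁ - 1) * ((((i + 1 : ℕ) : ℝ) * δ - 2 * β) * D i)
            = D i * (U / z i₁) * (z i₁ - z (i + 1)) := by
          have : U / z i₁ * z i₁ = U := div_mul_cancel₀ _ hzi₁.ne'
          simp only [hz] at this ⊢
          linear_combination (-D i) * this
        rw [h2]
        exact mul_nonneg (mul_nonneg (hD i) (by positivity)) (by linarith)
      linarith
    | succ j hj ih =>
      intro hjn
      have ih := ih (by omega)
      have hzj : 0 < z j := hzi₁.trans_le (hz_mono hj)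
      have hzj1 : 0 < z (j + 1) := by rw [hz_succ]; linarith
      have hSj := hSlt j (by omega)
      have hS1 : S (j + 1) = S j + z (j + 1) * D j := by
        simp only [hS, hz, Finset.sum_range_succ]
      have hP1 : P (j + 1) = P j + (U - z (j + 1)) * D j := by
        simp only [hP, hz, Finset.sum_range_succ]
      have e1 : U / z (j + 1) * z (j + 1) = U := div_mul_cancel₀ _ hzj1.ne'
      have hstep : P (j + 1) - (U / z (j + 1) - 1) * S (j + 1)
          = P j - (U / z j - 1) * S j + (U / z j - U / z (j + 1)) * S j := by
        rw [hS1, hP1]; linear_combination (-D j) * e1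
      have hdec : 0 ≤ U / z j - U / z (j + 1) :=
        sub_nonneg.2 (div_le_div_of_nonneg_left hU.le hzj (hz_mono j.le_succ))
      have h3 := mul_le_mul_of_nonneg_left hSj.le hdec
      have hlog : Real.log ((z (j + 1) + δ) / (z i₁ + δ))
          ≤ Real.log ((z j + δ) / (z i₁ + δ)) + δ / z (j + 1) := by
        rw [Real.log_div (by linarith) (by linarith), Real.log_div (by linarith) (by linarith),
          ← hz_succ j]
        have h5 : Real.log (z (j + 1) + δ) - Real.log (z (j + 1)) ≤ δ / z (j + 1) := by
          rw [← Real.log_div (by linarith) (by linarith)]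
          refine (Real.log_le_sub_one_of_pos (by positivity)).trans ?_
          rw [add_div, div_self hzj1.ne']; linarith
        linarith
      have h6 := mul_le_mul_of_nonneg_left hlog (mul_pos hq hU).le
      have e2 : q * U * (δ / z (j + 1)) = q * δ * (U / z (j + 1)) := by ring
      rw [hstep]
      push_cast
      rw [mul_add, e2] at h6
      linarith
  have hfin := key n hi₁n le_rfl
  rw [hnδ] at hfin
  have hSn := hSlt n le_rfl
  rw [hnδ] at hSn
  have hzn0 : 0 < z n := hzi₁.trans_le (hz_mono hi₁n)
  have hΛn : 0 ≤ U / z n - 1 := by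
    rw [sub_nonneg, le_div_iff₀ hzn0, hzn]; linarith
  have h1 := mul_le_mul_of_nonneg_left hSn.le hΛn
  -- One `δ` is lost by rounding `i₁` up, the other by the shift in the logarithm.
  have hlog : r - 2 * δ / κ ≤ Real.log ((z n + δ) / (z i₁ + δ)) := by
    have ha : 0 < U - 2 * β - L := by linarith
    have h2 : (U - 2 * β - L) / (κ + 2 * δ) ≤ (z n + δ) / (z i₁ + δ) := by
      apply div_le_div₀
      · rw [hzn]; linarith
      · rw [hzn]; linarith
      · linarith
      · simp only [hz]; linarith
    refine le_trans ?_ (Real.log_le_log (by positivity) h2)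
    rw [Real.log_div ha.ne' (by positivity)]
    have h3 : Real.log κ = Real.log (U - 2 * β - L) - r := by
      rw [h_eq, Real.log_mul ha.ne' (Real.exp_ne_zero _), Real.log_exp]; ring
    have h4 : Real.log (κ + 2 * δ) - Real.log κ ≤ 2 * δ / κ := by
      rw [← Real.log_div (by positivity) hκ0.ne']
      refine (Real.log_le_sub_one_of_pos (by positivity)).trans ?_
      rw [add_div, div_self hκ0.ne']; linarith
    linarith
  have h2 := mul_le_mul_of_nonneg_left hlog (mul_pos hq hU).le
  rw [mul_sub] at h2
  -- collect: `(U / z) ε` exceeds `(U / z - 1) (U - q y) - q U (2 δ / κ)`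
  set y := U - i₁ * δ with hy
  have hyr : y ≤ U * r := by linarith
  have hyq : U * (1 - q * r) ≤ U - q * y := by
    linarith [mul_le_mul_of_nonneg_left hyr hq.le]
  have h3 : (U / z i₁ - 1) * (U - q * y) < U / z i₁ * ε + q * U * (2 * δ / κ) := by
    have : q * (U - L - i₁ * δ) = q * y - q * L := by rw [hy]; ring
    have h7 : q * y ≤ q * (U * r) := mul_le_mul_of_nonneg_left hyr hq.le
    linarith
  have hzU : z i₁ ≤ U - L := by
    have := hz_mono hi₁n
    linarith
  have e3 : U / z i₁ * z i₁ = U := div_mul_cancel₀ _ hzi₁.ne'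
  have h4 := mul_lt_mul_of_pos_right h3 hzi₁
  have h5 : (U / z i₁ - 1) * (U - q * y) * z i₁ = (U - z i₁) * (U - q * y) := by
    linear_combination (U - q * y) * e3
  have h6 : (U / z i₁ * ε + q * U * (2 * δ / κ)) * z i₁
      = U * ε + q * U * (2 * δ / κ) * z i₁ := by
    linear_combination ε * e3
  rw [h5, h6] at h4
  -- Because `U - z i₁ ≥ L`, the slack is at least `2 ε U`. The two error terms in `h4` amount to at
  -- most `2 ε U`, and `h4` is strict.
  have h7 : L * (U * (1 - q * r)) ≤ (U - z i₁) * (U - q * y) :=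
    mul_le_mul (by linarith) hyq (mul_nonneg hU.le (by linarith)) (by linarith)
  have h8 : q * U * (2 * δ / κ) * z i₁ ≤ ε * U :=
    mul_le_mul hsmall.le (by linarith) hzi₁.le (by positivity)
  have h9 : L * (U * (1 - q * r)) = 2 * ε * U := by rw [hε]; ring
  linarith

end CFL

namespace CFL

/-! ### The adaptive adversary -/

/-- The response at time `t` depends on the levels up to time `t` only. -/
def Causal (u : (ℕ → ℕ) → ℕ → ℝ) : Prop :=
  ∀ l l' t, (∀ s ≤ t, l s = l' s) → u l t = u l' t

/-- The discounted amount bought at a `Down` level at time `t`, minus the increase of the decision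
at time `t`. -/
def excess (ρ : ℝ) (u : (ℕ → ℕ) → ℕ → ℝ) (l : ℕ → ℕ) (t : ℕ) : ℝ :=
  (1 - 2 * ρ) * (if l t = 0 then 0 else u l t) - max (u l t - u l (t - 1)) 0

theorem Causal.excess {u : (ℕ → ℕ) → ℕ → ℝ} (hu : Causal u) (ρ : ℝ) :
    Causal (CFL.excess ρ u) := by
  intro l l' t h
  have h1 := hu l l' t h
  have h2 := hu l l' (t - 1) fun s hs => h s (by omega)
  simp only [CFL.excess, h1, h2, h t le_rfl]

theorem Causal.sum_congr {u : (ℕ → ℕ) → ℕ → ℝ} (hu : Causal u) {l l' : ℕ → ℕ} {a b : ℕ}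
    (h : ∀ s ≤ b, l s = l' s) : ∑ t ∈ Finset.Ioc a b, u l t = ∑ t ∈ Finset.Ioc a b, u l' t :=
  Finset.sum_congr rfl fun t ht =>
    hu l l' t fun s hs => h s (hs.trans (Finset.mem_Ioc.1 ht).2)

theorem sub_le_sum_max_sub (v : ℕ → ℝ) (c s : ℕ) :
    v (c + s) - v c ≤ ∑ t ∈ Finset.Ioc c (c + s), max (v t - v (t - 1)) 0 := by
  induction s with
  | zero => simp
  | succ s ih =>
    rw [← add_assoc, Finset.sum_Ioc_succ_top (by omega)]
    have := le_max_left (v (c + s + 1) - v (c + s + 1 - 1)) 0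
    rw [Nat.add_sub_cancel] at this ⊢
    linarith

theorem sum_Ioc_le_sum_range {v θ : ℕ → ℝ} (hθ : 0 ≤ θ 0) (c s : ℕ)
    (h : ∀ r, 1 ≤ r → r ≤ s → v (c + r) ≤ θ r) :
    ∑ t ∈ Finset.Ioc c (c + s), v t ≤ ∑ r ∈ Finset.range (s + 1), θ r := by
  induction s with
  | zero => simpa using hθ
  | succ s ih =>
    rw [← add_assoc, Finset.sum_Ioc_succ_top (by omega), Finset.sum_range_succ]
    have h1 := ih fun r h1 h2 => h r h1 (by omega)
    have h2 := h (s + 1) (by omega) le_rfl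
    rw [← add_assoc] at h2
    linarith

/-- Rapidly increasing thresholds. -/
theorem exists_thresholds {ρ η : ℝ} (hρ : 0 < ρ) (hη : 0 < η) (m : ℕ) :
    ∃ θ : ℕ → ℝ, 0 < θ 0 ∧ (∀ s, θ 0 ≤ θ s) ∧
      (∀ s, ∑ r ∈ Finset.range s, θ r ≤ ρ * θ s) ∧ ∑ r ∈ Finset.range (m + 1), θ r ≤ η := by
  -- With this ratio, `ρ M ^ s` grows by exactly `M ^ s` at each step.
  set M := 1 + 1 / ρ with hM
  have hM1 : 1 ≤ M := by
    have : 0 < 1 / ρ := by positivity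
    linarith
  have hM0 : 0 < M := by linarith
  have hρM : ρ * (M - 1) = 1 := by rw [hM]; field_simp; ring
  have hsum : ∀ s, ∑ r ∈ Finset.range s, M ^ r ≤ ρ * M ^ s := by
    intro s
    induction s with
    | zero => simpa using hρ.le
    | succ s ih =>
      rw [Finset.sum_range_succ, pow_succ]
      have : ρ * (M ^ s * M) = ρ * M ^ s + M ^ s := by linear_combination M ^ s * hρM
      linarith
  set A := η / (ρ * M ^ (m + 1)) with hA
  have hA0 : 0 < A := by positivity
  have hAη : A * (ρ * M ^ (m + 1)) = η := div_mul_cancel₀ _ (by positivity)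
  refine ⟨fun s => A * M ^ s, by simpa using hA0, fun s => ?_, fun s => ?_, ?_⟩
  · simpa using le_mul_of_one_le_right hA0.le (one_le_pow₀ hM1)
  · rw [← Finset.mul_sum]
    nlinarith [hsum s]
  · rw [← Finset.mul_sum, ← hAη]
    exact mul_le_mul_of_nonneg_left (hsum _) hA0.le

/-- One level of the adversary: from any history, either the total amount bought reaches `K`, or the
amount bought during the level is matched by increases of the decision. -/
theorem exists_level_extension {u : (ℕ → ℕ) → ℕ → ℝ} (hu : Causal u) (hu0 : ∀ l t, 0 ≤ u l t)
    {ρ η K : ℝ} (hρ0 : 0 < ρ) (hρ : ρ ≤ 1 / 2) {m i : ℕ} (hi : i ≠ 0) {θ : ℕ → ℝ} (hθ0 : 0 < θ 0)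
    (hθle : ∀ s, θ 0 ≤ θ s) (hθsum : ∀ s, ∑ r ∈ Finset.range s, θ r ≤ ρ * θ s)
    (hθη : ∑ r ∈ Finset.range (m + 1), θ r ≤ η) (r : ℕ) :
    ∀ (l : ℕ → ℕ) (a : ℕ), K ≤ ∑ t ∈ Finset.Ioc 0 a, u l t + r * θ 0 →
      ∃ (l' : ℕ → ℕ) (b : ℕ), a + m ≤ b ∧ b ≤ a + (r + 1) * (m + 1) ∧ (∀ t ≤ a, l' t = l t) ∧
        (∀ t ∈ Finset.Ioc a b, l' t = 0 ∨ l' t = i) ∧ (∀ t ∈ Finset.Ioc (b - m) b, l' t = i) ∧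
        (K ≤ ∑ t ∈ Finset.Ioc 0 b, u l' t ∨ ∑ t ∈ Finset.Ioc a b, excess ρ u l' t ≤ η) := by
  -- `r` is the number of retries left; each one adds at least `θ 0` to the total bought.
  induction r with
  | zero =>
    intro l a hK
    set l' : ℕ → ℕ := fun t => if t ≤ a then l t else i with hl'
    have hag : ∀ t ≤ a, l' t = l t := fun t ht => if_pos ht
    have hD : ∀ t ∈ Finset.Ioc a (a + m), l' t = i := fun t ht =>
      if_neg (not_le.2 (Finset.mem_Ioc.1 ht).1)
    refine ⟨l', a + m, le_rfl, by omega, hag, fun t ht => Or.inr (hD t ht),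
      by simpa using hD, Or.inl ?_⟩
    rw [← Finset.sum_Ioc_consecutive _ (Nat.zero_le a) (Nat.le_add_right a m), hu.sum_congr hag]
    have : 0 ≤ ∑ t ∈ Finset.Ioc a (a + m), u l' t := Finset.sum_nonneg fun t _ => hu0 _ _
    simp at hK
    linarith
  | succ r ih =>
    intro l a hK
    -- One `Up`, then `Down^i` forever. By causality, revising this plan after a cut time leaves the
    -- response up to that time unchanged.
    set l' : ℕ → ℕ := fun t => if t ≤ a then l t else if t = a + 1 then 0 else i with hl'
    have hag : ∀ t ≤ a, l' t = l t := fun t ht => if_pos ht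
    have hup : l' (a + 1) = 0 := by simp [hl']
    have hdown : ∀ t, a + 1 < t → l' t = i := by
      intro t ht
      simp only [hl']
      rw [if_neg (by omega), if_neg (by omega)]
    -- the recursive step, once a cut time `c` with enough progress is found
    have retry : ∀ s ≤ m, θ 0 ≤ u l' (a + 1 + s) →
        ∑ t ∈ Finset.Ioc a (a + 1 + s), excess ρ u l' t ≤ 0 →
        ∃ (l' : ℕ → ℕ) (b : ℕ), a + m ≤ b ∧ b ≤ a + (r + 1 + 1) * (m + 1) ∧
        (∀ t ≤ a, l' t = l t) ∧
        (∀ t ∈ Finset.Ioc a b, l' t = 0 ∨ l' t = i) ∧ (∀ t ∈ Finset.Ioc (b - m) b, l' t = i) ∧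
        (K ≤ ∑ t ∈ Finset.Ioc 0 b, u l' t ∨ ∑ t ∈ Finset.Ioc a b, excess ρ u l' t ≤ η) := by
      intro s hs hprog hex
      have hK' : K ≤ ∑ t ∈ Finset.Ioc 0 (a + 1 + s), u l' t + r * θ 0 := by
        rw [← Finset.sum_Ioc_consecutive _ (Nat.zero_le a) (by omega : a ≤ a + 1 + s),
          hu.sum_congr hag]
        have h1 : u l' (a + 1 + s) ≤ ∑ t ∈ Finset.Ioc a (a + 1 + s), u l' t :=
          Finset.single_le_sum (fun t _ => hu0 l' t) (Finset.mem_Ioc.2 ⟨by omega, le_rfl⟩)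
        push_cast at hK
        linarith
      obtain ⟨l₂, b, hb1, hb2, h1, h2, h3, h4⟩ := ih l' _ hK'
      refine ⟨l₂, b, by omega, ?_, fun t ht => (h1 t (by omega)).trans (hag t ht), ?_, h3, ?_⟩
      · have : (r + 1 + 1) * (m + 1) = (r + 1) * (m + 1) + (m + 1) := by ring
        omega
      · intro t ht
        rw [Finset.mem_Ioc] at ht
        by_cases htc : t ≤ a + 1 + s
        · rw [h1 t htc]
          by_cases hta : t = a + 1
          · exact Or.inl (hta ▸ hup)
          · exact Or.inr (hdown t (by omega))
        · exact h2 t (Finset.mem_Ioc.2 ⟨by omega, ht.2⟩)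
      · refine h4.imp_right fun h4 => ?_
        rw [← Finset.sum_Ioc_consecutive _ (by omega : a ≤ a + 1 + s) (by omega : a + 1 + s ≤ b),
          (hu.excess ρ).sum_congr h1]
        linarith
    have hexup : excess ρ u l' (a + 1) ≤ 0 := by
      simp [excess, hup]
    by_cases hbig : θ 0 ≤ u l' (a + 1)
    · refine retry 0 (Nat.zero_le m) hbig ?_
      simpa using hexup
    push Not at hbig
    have hexsum : ∀ s, ∑ t ∈ Finset.Ioc a (a + 1 + s), excess ρ u l' t
        ≤ (1 - 2 * ρ) * ∑ t ∈ Finset.Ioc (a + 1) (a + 1 + s), u l' t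
          - (u l' (a + 1 + s) - u l' (a + 1)) := by
      intro s
      rw [← Finset.sum_Ioc_consecutive _ (by omega : a ≤ a + 1) (by omega : a + 1 ≤ a + 1 + s)]
      have h1 : ∑ t ∈ Finset.Ioc (a + 1) (a + 1 + s), excess ρ u l' t
          = (1 - 2 * ρ) * ∑ t ∈ Finset.Ioc (a + 1) (a + 1 + s), u l' t
            - ∑ t ∈ Finset.Ioc (a + 1) (a + 1 + s), max (u l' t - u l' (t - 1)) 0 := by
        rw [Finset.mul_sum, ← Finset.sum_sub_distrib]
        refine Finset.sum_congr rfl fun t ht => ?_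
        rw [excess, hdown t (Finset.mem_Ioc.1 ht).1, if_neg hi]
      have h2 := sub_le_sum_max_sub (u l') (a + 1) s
      have h3 : ∑ t ∈ Finset.Ioc a (a + 1), excess ρ u l' t ≤ 0 := by simpa using hexup
      linarith
    by_cases hbreak : ∃ s, 1 ≤ s ∧ s ≤ m ∧ θ s < u l' (a + 1 + s)
    · classical
      obtain ⟨hs1, hsm, hsθ⟩ := Nat.find_spec hbreak
      have hmin := fun s (hs : s < Nat.find hbreak) => Nat.find_min hbreak hs
      generalize Nat.find hbreak = s at hs1 hsm hsθ hmin
      -- At the first crossing let `x` be the new decision. Both the earlier `Down` purchases of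
      -- this attempt and the decision at `a + 1` are at most `ρ x`. The excess is then at most `(1
      -- - 2 ρ)(1 + ρ) x - x + ρ x = -2 ρ² x`.
      refine retry s hsm ((hθle s).trans hsθ.le) ((hexsum s).trans ?_)
      obtain ⟨s', rfl⟩ : ∃ s', s = s' + 1 := ⟨s - 1, by omega⟩
      have h1 : ∑ t ∈ Finset.Ioc (a + 1) (a + 1 + s'), u l' t
          ≤ ∑ r ∈ Finset.range (s' + 1), θ r := by
        refine sum_Ioc_le_sum_range hθ0.le _ _ fun q hq1 hq2 => ?_
        have := hmin q (by omega)
        push Not at this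
        exact this hq1 (by omega)
      have h2 := hθsum (s' + 1)
      have h3 : θ 0 ≤ ∑ r ∈ Finset.range (s' + 1), θ r :=
        Finset.single_le_sum (fun q _ => hθ0.le.trans (hθle q)) (by simp)
      rw [← add_assoc (a + 1), Finset.sum_Ioc_succ_top (by omega)]
      rw [← add_assoc (a + 1)] at hsθ
      set x := u l' (a + 1 + s' + 1)
      have h4 : ρ * θ (s' + 1) ≤ ρ * x := by gcongr
      have h5 : 0 ≤ x := hu0 _ _
      have h6 : (1 - 2 * ρ) * (∑ t ∈ Finset.Ioc (a + 1) (a + 1 + s'), u l' t + x)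
          ≤ (1 - 2 * ρ) * (ρ * x + x) :=
        mul_le_mul_of_nonneg_left (by linarith) (by linarith)
      nlinarith [mul_nonneg (mul_nonneg hρ0.le hρ0.le) h5]
    · push Not at hbreak
      refine ⟨l', a + 1 + m, by omega, ?_, hag, ?_, ?_, Or.inr ((hexsum m).trans ?_)⟩
      · have : (r + 1 + 1) * (m + 1) = (r + 1) * (m + 1) + (m + 1) := by ring
        omega
      · intro t ht
        rw [Finset.mem_Ioc] at ht
        by_cases hta : t = a + 1
        · exact Or.inl (hta ▸ hup)
        · exact Or.inr (hdown t (by omega))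
      · intro t ht
        rw [Finset.mem_Ioc] at ht
        exact hdown t (by omega)
      · have h1 : ∑ t ∈ Finset.Ioc (a + 1) (a + 1 + m), u l' t
            ≤ ∑ q ∈ Finset.range (m + 1), θ q - θ 0 := by
          -- Zeroing the first threshold reserves `θ 0` to absorb the decision at `a + 1`.
          have := sum_Ioc_le_sum_range (v := u l') (θ := fun s => if s = 0 then 0 else θ s)
            (by simp) (a + 1) m fun q hq1 hq2 => by
              rw [if_neg (by omega)]; exact hbreak q hq1 hq2
          rw [Finset.sum_range_succ'] at this ⊢
          simpa using this
        have h2 : 0 ≤ ∑ t ∈ Finset.Ioc (a + 1) (a + 1 + m), u l' t :=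
          Finset.sum_nonneg fun t _ => hu0 _ _
        have h3 := hu0 l' (a + 1 + m)
        nlinarith

/-- The adversary through all `n` levels; level `i + 1` occupies the times in `(τ i, τ (i + 1)]`. -/
theorem exists_adversary {ρ η : ℝ} (hρ0 : 0 < ρ) (hρ : ρ ≤ 1 / 2) (hη : 0 < η) (K : ℝ) (m n : ℕ) :
    ∃ B : ℕ, ∀ u : (ℕ → ℕ) → ℕ → ℝ, Causal u → (∀ l t, 0 ≤ u l t) →
      ∃ (l τ : ℕ → ℕ), τ 0 = 0 ∧ ∀ j < n, τ j + m ≤ τ (j + 1) ∧ τ (j + 1) ≤ B ∧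
        (∀ t ∈ Finset.Ioc (τ j) (τ (j + 1)), l t = 0 ∨ l t = j + 1) ∧
        (∀ t ∈ Finset.Ioc (τ (j + 1) - m) (τ (j + 1)), l t = j + 1) ∧
        (K ≤ ∑ t ∈ Finset.Ioc 0 (τ (j + 1)), u l t ∨
          ∑ t ∈ Finset.Ioc (τ j) (τ (j + 1)), excess ρ u l t ≤ η) := by
  obtain ⟨θ, hθ0, hθle, hθsum, hθη⟩ := exists_thresholds hρ0 hη m
  obtain ⟨r, hr⟩ := exists_nat_ge (K / θ 0)
  rw [div_le_iff₀ hθ0] at hr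
  set C := (r + 1) * (m + 1)
  -- The bound must not depend on `u`: the horizon is fixed first, and the algorithm's response
  -- depends on it.
  refine ⟨n * C, fun u hu hu0 => ?_⟩
  suffices H : ∀ n, ∃ (l τ : ℕ → ℕ), τ 0 = 0 ∧ τ n ≤ n * C ∧ ∀ j < n, τ j + m ≤ τ (j + 1) ∧
      τ (j + 1) ≤ τ n ∧
      (∀ t ∈ Finset.Ioc (τ j) (τ (j + 1)), l t = 0 ∨ l t = j + 1) ∧
      (∀ t ∈ Finset.Ioc (τ (j + 1) - m) (τ (j + 1)), l t = j + 1) ∧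
      (K ≤ ∑ t ∈ Finset.Ioc 0 (τ (j + 1)), u l t ∨
        ∑ t ∈ Finset.Ioc (τ j) (τ (j + 1)), excess ρ u l t ≤ η) by
    obtain ⟨l, τ, h0, hn, h⟩ := H n
    refine ⟨l, τ, h0, fun j hj => ?_⟩
    obtain ⟨h1, h2, h3⟩ := h j hj
    exact ⟨h1, h2.trans hn, h3⟩
  intro n
  induction n with
  | zero => exact ⟨0, 0, rfl, by simp, fun j hj => absurd hj (by omega)⟩
  | succ n ih =>
    obtain ⟨l, τ, h0, hn, h⟩ := ih
    obtain ⟨l', b, hb1, hb2, hag, h2, h3, h4⟩ :=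
      exists_level_extension hu hu0 (K := K) hρ0 hρ (Nat.succ_ne_zero n) hθ0 hθle hθsum hθη r l
        (τ n) (by
          have : 0 ≤ ∑ t ∈ Finset.Ioc 0 (τ n), u l t := Finset.sum_nonneg fun t _ => hu0 _ _
          linarith)
    have hτ : ∀ j ≤ n, Function.update τ (n + 1) b j = τ j := fun j hj =>
      Function.update_of_ne (by omega) _ _
    have hτb : Function.update τ (n + 1) b (n + 1) = b := Function.update_self _ _ _
    refine ⟨l', Function.update τ (n + 1) b, by rw [hτ 0 (Nat.zero_le n), h0], ?_, fun j hj => ?_⟩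
    · rw [hτb, add_mul, one_mul]
      omega
    · rw [hτb, hτ j (by omega)]
      rcases Nat.lt_succ_iff_lt_or_eq.1 hj with hj | rfl
      · rw [hτ (j + 1) hj]
        obtain ⟨g1, g2, g3, g4, g5⟩ := h j hj
        refine ⟨g1, by omega, fun t ht => ?_, fun t ht => ?_, ?_⟩
        · rw [hag t ((Finset.mem_Ioc.1 ht).2.trans g2)]; exact g3 t ht
        · rw [hag t ((Finset.mem_Ioc.1 ht).2.trans g2)]; exact g4 t ht
        · rwa [hu.sum_congr fun s hs => hag s (hs.trans g2),
            (hu.excess ρ).sum_congr fun s hs => hag s (hs.trans g2)]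
      · rw [hτb]
        exact ⟨hb1, le_rfl, h2, h3, h4⟩

end CFL

namespace CFL

/-! ### The constant `α` -/

theorem strictMonoOn_mul_exp : StrictMonoOn (fun v : ℝ => v * Real.exp v) (Set.Ici (-1)) := by
  refine strictMonoOn_of_deriv_pos (convex_Ici _) (by fun_prop) fun x hx => ?_
  rw [interior_Ici, Set.mem_Ioi] at hx
  have : HasDerivAt (fun v : ℝ => v * Real.exp v) (1 * Real.exp x + x * Real.exp x) x :=
    (hasDerivAt_id x).mul (Real.hasDerivAt_exp x)
  rw [this.deriv, ← add_mul]
  exact mul_pos (by linarith) (Real.exp_pos x)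

theorem lambertW_mul_exp {v : ℝ} (hv : -1 ≤ v) : lambertW (v * Real.exp v) = v := by
  have h : ∃ a ∈ Set.Ici (-1 : ℝ), (fun v : ℝ => v * Real.exp v) a = v * Real.exp v :=
    ⟨v, hv, rfl⟩
  exact strictMonoOn_mul_exp.injOn (Function.invFunOn_mem h) hv (Function.invFunOn_eq h)

namespace Setting

variable {d : ℕ} (S : Setting d)

theorem beta_eq {k : Fin d} (hk : ∀ i, S.w i / S.c i ≤ S.w k / S.c k) :
    S.beta = S.w k / S.c k := by
  have : Nonempty (Fin d) := ⟨k⟩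
  exact le_antisymm (ciSup_le hk) (le_ciSup (Set.finite_range fun i => S.w i / S.c i).bddAbove k)

theorem beta_nonneg : 0 ≤ S.beta :=
  Real.iSup_nonneg fun i => div_nonneg (S.w_nonneg i) (S.c_pos i).le

theorem two_mul_beta_lt : 2 * S.beta < S.U - S.L := by
  have := S.beta_lt
  simp only [beta]
  linarith

theorem L_lt_U : S.L < S.U := by linarith [S.two_mul_beta_lt, S.beta_nonneg]

theorem U_pos : 0 < S.U := S.L_pos.trans S.L_lt_U

/-- Replaces Lambert `W` by the implicit equation used in the linear program. The root comes from
the intermediate value theorem, and `r + b - 1 ≥ -1` puts it on the principal branch. -/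
theorem exists_alpha_eq_inv : ∃ r, 0 < r ∧ S.U * r < S.U - 2 * S.beta ∧
    S.U - 2 * S.beta - S.U * r = (S.U - 2 * S.beta - S.L) * Real.exp (-r) ∧ S.alpha = r⁻¹ := by
  have hU := S.U_pos
  have hβ := S.two_mul_beta_lt
  set b := 2 * S.beta / S.U with hb
  have hbU : b * S.U = 2 * S.beta := div_mul_cancel₀ _ hU.ne'
  set c := S.L / S.U with hc
  have hcU : c * S.U = S.L := div_mul_cancel₀ _ hU.ne'
  have hc0 : 0 < c := div_pos S.L_pos hU
  have hb0 : 0 ≤ b := div_nonneg (by linarith [S.beta_nonneg]) hU.le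
  have hbc : 0 < 1 - b - c := by
    have : 0 < (1 - b - c) * S.U := by linarith
    exact pos_of_mul_pos_left this hU.le
  obtain ⟨r, ⟨hr0, hr1⟩, hr⟩ := intermediate_value_Ioo' (by linarith : (0 : ℝ) ≤ 1 - b)
    (f := fun x => 1 - b - x - (1 - b - c) * Real.exp (-x)) (by fun_prop)
    (⟨by simpa using mul_pos hbc (Real.exp_pos _), by simpa using hc0⟩ : (0 : ℝ) ∈ Set.Ioo _ _)
  simp only at hr
  refine ⟨r, hr0, by nlinarith, ?_, ?_⟩
  · rw [← hbU, ← hcU]; linear_combination S.U * hr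
  · have h : (b + c - 1) * Real.exp (b - 1) = (r + b - 1) * Real.exp (r + b - 1) := by
      have h1 : Real.exp (r + b - 1) * Real.exp (-r) = Real.exp (b - 1) := by
        rw [← Real.exp_add]; congr 1; ring
      rw [← h1]
      linear_combination Real.exp (r + b - 1) * hr
    rw [alpha, ← hb, ← hc, h, lambertW_mul_exp (by linarith)]
    congr 1; ring

/-! ### Admissibility of the level costs -/

variable {S}

theorem wl1_eq_of_mem_X {x : Vec d} (hx : x ∈ S.X) : wl1 S.c x = ∑ i, S.c i * x i :=
  Finset.sum_congr rfl fun i _ => by rw [abs_of_nonneg (hx.1 i).1]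

theorem convex_X : Convex ℝ S.X := by
  intro x hx y hy a b ha hb hab
  have h1 : ∀ i, 0 ≤ (a • x + b • y) i ∧ (a • x + b • y) i ≤ 1 := by
    intro i
    simp only [Pi.add_apply, Pi.smul_apply, smul_eq_mul]
    have hxi := hx.1 i
    have hyi := hy.1 i
    constructor
    · exact add_nonneg (mul_nonneg ha hxi.1) (mul_nonneg hb hyi.1)
    · nlinarith
  refine ⟨h1, ?_⟩
  have h2 : wl1 S.c (a • x + b • y) = a * wl1 S.c x + b * wl1 S.c y := by
    rw [wl1_eq_of_mem_X hx, wl1_eq_of_mem_X hy, wl1, Finset.mul_sum, Finset.mul_sum,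
      ← Finset.sum_add_distrib]
    refine Finset.sum_congr rfl fun i _ => ?_
    rw [abs_of_nonneg (h1 i).1]
    simp only [Pi.add_apply, Pi.smul_apply, smul_eq_mul]
    ring
  have hx2 := hx.2
  have hy2 := hy.2
  rw [h2]
  nlinarith

theorem level_nonneg (n : ℕ) : 0 ≤ (S.U - S.L) / n :=
  div_nonneg (by linarith [S.L_lt_U]) (Nat.cast_nonneg n)

theorem L_le_price {n i : ℕ} (h : i ≤ n) : S.L ≤ S.U - i * ((S.U - S.L) / n) := by
  rcases Nat.eq_zero_or_pos n with rfl | hn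
  · simpa using S.L_lt_U.le
  · have hn' : (0 : ℝ) < n := by exact_mod_cast hn
    have h1 : (n : ℝ) * ((S.U - S.L) / n) = S.U - S.L := by field_simp
    have h2 : (i : ℝ) * ((S.U - S.L) / n) ≤ n * ((S.U - S.L) / n) :=
      mul_le_mul_of_nonneg_right (by exact_mod_cast h) (level_nonneg n)
    linarith

theorem price_le_U (n i : ℕ) : S.U - i * ((S.U - S.L) / n) ≤ S.U :=
  sub_le_self _ (mul_nonneg (Nat.cast_nonneg i) (level_nonneg n))

theorem isCost_levelCost (k : Fin d) {n i : ℕ} (h : i ≤ n) : S.IsCost (S.levelCost k n i) := by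
  set a : Fin d → ℝ := fun j => if j = k then S.U - i * ((S.U - S.L) / n) else S.U with ha
  set φ : Vec d →L[ℝ] ℝ :=
    ∑ j, (a j * S.c j) • (ContinuousLinearMap.proj (R := ℝ) (φ := fun _ : Fin d => ℝ) j) with hφ
  have hφx : S.levelCost k n i = φ := by
    ext x
    simp only [levelCost, hφ, sum_apply, smul_apply,
      ContinuousLinearMap.proj_apply, smul_eq_mul, ha]
  refine ⟨?_, ?_, fun x _ => ⟨φ, ?_, fun j => ?_⟩⟩
  · rw [hφx]; exact φ.toLinearMap.convexOn convex_X
  · rw [hφx]; exact map_zero φ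
  · rw [hφx]; exact φ.hasFDerivWithinAt
  · have h1 : φ (Pi.single j 1) / S.c j = a j := by
      have : φ (Pi.single j 1) = a j * S.c j := by
        simp [hφ, Pi.single_apply]
      rw [this, mul_div_cancel_right₀ _ (S.c_pos j).ne']
    rw [h1]
    simp only [ha]
    split_ifs
    · exact ⟨L_le_price h, price_le_U n i⟩
    · exact ⟨S.L_lt_U.le, le_rfl⟩

theorem levelCost_eq (k : Fin d) (n i : ℕ) {x : Vec d} (hx : x ∈ S.X) :
    S.levelCost k n i x = S.U * wl1 S.c x - i * ((S.U - S.L) / n) * (S.c k * x k) := by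
  have h : ∀ j, (if j = k then S.U - i * ((S.U - S.L) / n) else S.U) * S.c j * x j
      = S.U * (S.c j * x j) - if j = k then i * ((S.U - S.L) / n) * (S.c k * x k) else 0 := by
    intro j
    split_ifs with hj
    · subst hj; ring
    · ring
  rw [levelCost, Finset.sum_congr rfl fun j _ => h j, Finset.sum_sub_distrib, ← Finset.mul_sum,
    wl1_eq_of_mem_X hx]
  simp

theorem mul_wl1_le_levelCost (k : Fin d) {n i : ℕ} (h : i ≤ n) {x : Vec d} (hx : x ∈ S.X) :
    S.L * wl1 S.c x ≤ S.levelCost k n i x := by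
  rw [levelCost, wl1_eq_of_mem_X hx, Finset.mul_sum]
  refine Finset.sum_le_sum fun j _ => ?_
  rw [mul_assoc]
  refine mul_le_mul_of_nonneg_right ?_ (mul_nonneg (S.c_pos j).le (hx.1 j).1)
  split_ifs
  · exact L_le_price h
  · exact S.L_lt_U.le

theorem wl1_nonneg {a : Vec d} (ha : ∀ i, 0 ≤ a i) (x : Vec d) : 0 ≤ wl1 a x :=
  Finset.sum_nonneg fun i _ => mul_nonneg (ha i) (abs_nonneg _)

theorem mul_abs_le_wl1 {a : Vec d} (ha : ∀ i, 0 ≤ a i) (x : Vec d) (k : Fin d) :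
    a k * |x k| ≤ wl1 a x :=
  Finset.single_le_sum (f := fun i => a i * |x i|)
    (fun i _ => mul_nonneg (ha i) (abs_nonneg _)) (Finset.mem_univ k)

theorem wl1_single (a : Vec d) (k : Fin d) (y : ℝ) : wl1 a (Pi.single k y) = a k * |y| := by
  rw [wl1, Finset.sum_eq_single k]
  · simp
  · intro i _ hi; simp [Pi.single_eq_of_ne hi]
  · simp

/-! ### Spreading the demand evenly over a batch -/

/-- Buy the fraction `1 / m` in direction `k` at each of the times `τ + 1, …, τ + m`. -/
noncomputable def spread (S : Setting d) (k : Fin d) (τ m : ℕ) (t : ℕ) : Vec d :=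
  if t ∈ Finset.Ioc τ (τ + m) then Pi.single k (1 / (S.c k * m)) else 0

/-- The condition on `m` keeps the coordinate `1 / (c k * m)` at most `1`. -/
theorem isFeasible_spread {k : Fin d} {τ m T : ℕ} (hm : 1 ≤ m * S.c k) (hT : τ + m ≤ T) :
    S.IsFeasible T (S.spread k τ m) := by
  have hm0 : (0 : ℝ) < m := pos_of_mul_pos_left (by linarith) (S.c_pos k).le
  have hm1 : (1 : ℝ) ≤ m := by
    have : 0 < m := by exact_mod_cast hm0
    exact_mod_cast this
  have hck := S.c_pos k
  have hcm : S.c k * |1 / (S.c k * m)| = 1 / m := by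
    rw [abs_of_pos (by positivity)]; field_simp
  refine ⟨by simp [spread], by simp [spread]; omega, fun t _ => ?_, ?_⟩
  · unfold spread
    split_ifs
    · refine ⟨fun i => ?_, ?_⟩
      · rcases eq_or_ne i k with rfl | hi
        · simp only [Pi.single_eq_same]
          exact ⟨by positivity, by rw [div_le_one (by positivity)]; linarith⟩
        · simp [Pi.single_eq_of_ne hi]
      · rw [wl1_single, hcm, div_le_one hm0]; exact hm1
    · exact ⟨fun i => by simp, by simp [wl1]⟩
  · have h : ∀ t, wl1 S.c (S.spread k τ m t)
        = if t ∈ Finset.Ioc τ (τ + m) then 1 / (m : ℝ) else 0 := by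
      intro t
      unfold spread
      split_ifs
      · rw [wl1_single, hcm]
      · simp [wl1]
    simp only [h]
    rw [Finset.sum_ite_mem, Finset.inter_eq_right.2, Finset.sum_const, Nat.card_Ioc]
    · simp [hm0.ne']
    · intro t ht
      simp only [Finset.mem_Ioc, Finset.mem_Icc] at ht ⊢
      omega

/-! ### Bounds on the offline optimum -/

theorem mul_sum_le_totalCost {k : Fin d} {n : ℕ} {I : Input d} {l : ℕ → ℕ}
    (hI : ∀ t ∈ Finset.Icc 1 I.T, I.f t = S.levelCost k n (l t) ∧ l t ≤ n) {x : ℕ → Vec d}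
    (hx : S.IsFeasible I.T x) :
    S.L * ∑ t ∈ Finset.Icc 1 I.T, wl1 S.c (x t) ≤ S.totalCost I x := by
  have h1 : S.L * ∑ t ∈ Finset.Icc 1 I.T, wl1 S.c (x t)
      ≤ ∑ t ∈ Finset.Icc 1 I.T, I.f t (x t) := by
    rw [Finset.mul_sum]
    refine Finset.sum_le_sum fun t ht => ?_
    rw [(hI t ht).1]
    exact mul_wl1_le_levelCost k (hI t ht).2 (hx.2.2.1 t ht)
  have h2 : 0 ≤ ∑ t ∈ Finset.Icc 1 (I.T + 1), wl1 S.w (x t - x (t - 1)) :=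
    Finset.sum_nonneg fun t _ => wl1_nonneg S.w_nonneg _
  rw [totalCost]
  linarith

theorem L_le_totalCost {k : Fin d} {n : ℕ} {I : Input d} {l : ℕ → ℕ}
    (hI : ∀ t ∈ Finset.Icc 1 I.T, I.f t = S.levelCost k n (l t) ∧ l t ≤ n) {x : ℕ → Vec d}
    (hx : S.IsFeasible I.T x) : S.L ≤ S.totalCost I x :=
  (le_mul_of_one_le_right S.L_pos.le hx.2.2.2).trans (mul_sum_le_totalCost hI hx)

theorem L_le_opt {k : Fin d} {n : ℕ} {I : Input d} {l : ℕ → ℕ}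
    (hI : ∀ t ∈ Finset.Icc 1 I.T, I.f t = S.levelCost k n (l t) ∧ l t ≤ n)
    (hf : ∃ x, S.IsFeasible I.T x) : S.L ≤ S.opt I := by
  refine le_csInf ?_ ?_
  · obtain ⟨x, hx⟩ := hf
    exact ⟨_, x, hx, rfl⟩
  · rintro _ ⟨x, hx, rfl⟩
    exact L_le_totalCost hI hx

/-- `spread` pays the batch price for its single unit and moves only when entering and leaving the
batch, at `β / m` each time. -/
theorem opt_le {k : Fin d} (hk : ∀ i, S.w i / S.c i ≤ S.w k / S.c k) {n m j τ : ℕ} {I : Input d}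
    {l : ℕ → ℕ} (hI : ∀ t ∈ Finset.Icc 1 I.T, I.f t = S.levelCost k n (l t) ∧ l t ≤ n)
    (hj : ∀ t ∈ Finset.Ioc τ (τ + m), l t = j) (hm : 1 ≤ m * S.c k) (hT : τ + m ≤ I.T) :
    S.opt I ≤ S.U - j * ((S.U - S.L) / n) + 2 * S.beta / m := by
  have hx := isFeasible_spread hm hT
  have hbdd : BddBelow (S.totalCost I '' {x | S.IsFeasible I.T x}) :=
    ⟨S.L, by rintro _ ⟨x, hx, rfl⟩; exact L_le_totalCost hI hx⟩
  refine (csInf_le hbdd ⟨_, hx, rfl⟩).trans ?_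
  have hm0 : (0 : ℝ) < m := pos_of_mul_pos_left (by linarith) (S.c_pos k).le
  have hck := S.c_pos k
  set p := S.U - j * ((S.U - S.L) / n) with hp
  have hhit : ∑ t ∈ Finset.Icc 1 I.T, I.f t (S.spread k τ m t) = p := by
    have h : ∀ t ∈ Finset.Icc 1 I.T, I.f t (S.spread k τ m t)
        = if t ∈ Finset.Ioc τ (τ + m) then p / m else 0 := by
      intro t ht
      rw [(hI t ht).1]
      by_cases hmem : t ∈ Finset.Ioc τ (τ + m)
      · rw [levelCost_eq k n _ (hx.2.2.1 t ht), hj t hmem, spread, if_pos hmem, if_pos hmem,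
          wl1_single, abs_of_pos (by positivity), Pi.single_eq_same, hp]
        field_simp
      · rw [spread, if_neg hmem, if_neg hmem]
        simp [levelCost]
    rw [Finset.sum_congr rfl h, Finset.sum_ite_mem, Finset.inter_eq_right.2, Finset.sum_const,
      Nat.card_Ioc]
    · rw [Nat.add_sub_cancel_left, nsmul_eq_mul]; field_simp
    · intro t ht
      simp only [Finset.mem_Ioc, Finset.mem_Icc] at ht ⊢
      omega
  have hswitch : ∑ t ∈ Finset.Icc 1 (I.T + 1),
      wl1 S.w (S.spread k τ m t - S.spread k τ m (t - 1)) ≤ 2 * S.beta / m := by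
    have hβm : S.w k * |1 / (S.c k * m)| = S.beta / m := by
      rw [abs_of_pos (by positivity), S.beta_eq hk]; field_simp
    have hβm0 : 0 ≤ S.beta / m := div_nonneg S.beta_nonneg hm0.le
    have h : ∀ t ∈ Finset.Icc 1 (I.T + 1),
        wl1 S.w (S.spread k τ m t - S.spread k τ m (t - 1))
        ≤ (if t = τ + 1 then S.beta / m else 0) + (if t = τ + m + 1 then S.beta / m else 0) := by
      intro t ht
      have ht1 := (Finset.mem_Icc.1 ht).1
      have hz : (0 : ℝ) ≤ (if t = τ + 1 then S.beta / m else 0)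
          + (if t = τ + m + 1 then S.beta / m else 0) := by
        split_ifs <;> linarith
      unfold spread
      by_cases h1 : t ∈ Finset.Ioc τ (τ + m) <;> by_cases h2 : t - 1 ∈ Finset.Ioc τ (τ + m)
      · rw [if_pos h1, if_pos h2, sub_self]; simpa [wl1] using hz
      · rw [if_pos h1, if_neg h2, sub_zero, wl1_single, hβm]
        rw [Finset.mem_Ioc] at h1 h2
        rw [if_pos (by omega : t = τ + 1)]
        split_ifs <;> linarith
      · rw [if_neg h1, if_pos h2, zero_sub, ← Pi.single_neg, wl1_single, abs_neg, hβm]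
        rw [Finset.mem_Ioc] at h1 h2
        rw [if_pos (by omega : t = τ + m + 1)]
        split_ifs <;> linarith
      · rw [if_neg h1, if_neg h2, sub_self]; simpa [wl1] using hz
    refine (Finset.sum_le_sum h).trans ?_
    rw [Finset.sum_add_distrib, Finset.sum_ite_eq', Finset.sum_ite_eq']
    have : 2 * S.beta / m = S.beta / m + S.beta / m := by ring
    split_ifs <;> linarith
  rw [totalCost]
  linarith

theorem yFamily_subset_instances (k : Fin d) (N : ℕ) : S.yFamily k N ⊆ S.instances := by
  rintro I ⟨⟨n, m, j, -, -, hjn, l, τ, hI, -⟩, hT⟩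
  refine ⟨fun t ht => ?_, ?_⟩
  · rw [(hI t ht).1]
    exact isCost_levelCost k ((hI t ht).2.trans hjn)
  -- The case `j' = 0` already leaves enough time to spread one unit over the whole horizon.
  · obtain ⟨i, hi⟩ := hT 0 (Nat.zero_le N)
    refine ⟨S.spread i 0 I.T, isFeasible_spread ?_ (by simp)⟩
    have := S.c_pos i
    push_cast at hi
    linarith

/-! ### Lower bound on the cost of a decision sequence -/

theorem Icc_one_eq_Ioc (T : ℕ) : Finset.Icc 1 T = Finset.Ioc 0 T := by
  ext t; simp only [Finset.mem_Icc, Finset.mem_Ioc]; omega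

/-- A path from zero back to zero falls as much as it rises. -/
theorem two_mul_rise_le (v : ℕ → ℝ) {τ T : ℕ} (hτ : τ ≤ T) (h0 : v 0 = 0) (hT : v T = 0) :
    2 * ∑ t ∈ Finset.Ioc 0 τ, max (v t - v (t - 1)) 0
      ≤ ∑ t ∈ Finset.Ioc 0 T, |v t - v (t - 1)| := by
  have htel : ∀ s, ∑ t ∈ Finset.Ioc 0 s, (v t - v (t - 1)) = v s - v 0 := by
    intro s
    induction s with
    | zero => simp
    | succ s ih =>
      rw [Finset.sum_Ioc_succ_top (Nat.zero_le s), ih, Nat.add_sub_cancel]; ring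
  have h1 : ∀ a : ℝ, |a| = 2 * max a 0 - a := by
    intro a
    rcases le_total a 0 with h | h
    · rw [abs_of_nonpos h, max_eq_right h]; ring
    · rw [abs_of_nonneg h, max_eq_left h]; ring
  simp only [h1]
  rw [Finset.sum_sub_distrib, htel, h0, hT, ← Finset.mul_sum]
  have : ∑ t ∈ Finset.Ioc 0 τ, max (v t - v (t - 1)) 0
      ≤ ∑ t ∈ Finset.Ioc 0 T, max (v t - v (t - 1)) 0 :=
    Finset.sum_le_sum_of_subset_of_nonneg (Finset.Ioc_subset_Ioc_right hτ)
      fun _ _ _ => le_max_right _ _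
  linarith

/-- Switching in other directions is discarded. Since `w k = β c k`, movement in direction `k` costs
`β` times the change in the amount bought, and the return to the origin doubles the rises. -/
theorem le_totalCost {k : Fin d} (hk : ∀ i, S.w i / S.c i ≤ S.w k / S.c k) {n τ : ℕ} {I : Input d}
    {l : ℕ → ℕ} (hI : ∀ t ∈ Finset.Icc 1 I.T, I.f t = S.levelCost k n (l t))
    (hτ : τ ≤ I.T) (hl : ∀ t, τ < t → l t = 0) {x : ℕ → Vec d} (hx : S.IsFeasible I.T x) :
    S.U * ∑ t ∈ Finset.Icc 1 I.T, wl1 S.c (x t)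
      - (S.U - S.L) / n * ∑ t ∈ Finset.Ioc 0 τ, l t * (S.c k * |x t k|)
      + 2 * S.beta * ∑ t ∈ Finset.Ioc 0 τ,
          max (S.c k * |x t k| - S.c k * |x (t - 1) k|) 0
    ≤ S.totalCost I x := by
  obtain ⟨hx0, hxT, hxX, -⟩ := hx
  have hhit : ∑ t ∈ Finset.Icc 1 I.T, I.f t (x t) = S.U * ∑ t ∈ Finset.Icc 1 I.T, wl1 S.c (x t)
      - (S.U - S.L) / n * ∑ t ∈ Finset.Ioc 0 τ, l t * (S.c k * |x t k|) := by
    have h1 : ∑ t ∈ Finset.Ioc 0 τ, l t * (S.c k * |x t k|)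
        = ∑ t ∈ Finset.Icc 1 I.T, l t * (S.c k * |x t k|) := by
      rw [Icc_one_eq_Ioc]
      refine Finset.sum_subset (Finset.Ioc_subset_Ioc_right hτ) fun t ht ht' => ?_
      rw [Finset.mem_Ioc] at ht ht'
      rw [hl t (by omega)]
      simp
    rw [h1, Finset.mul_sum, Finset.mul_sum, ← Finset.sum_sub_distrib]
    refine Finset.sum_congr rfl fun t ht => ?_
    rw [hI t ht, levelCost_eq k n _ (hxX t ht), abs_of_nonneg ((hxX t ht).1 k).1]
    ring
  have hswitch : 2 * S.beta * ∑ t ∈ Finset.Ioc 0 τ,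
        max (S.c k * |x t k| - S.c k * |x (t - 1) k|) 0
      ≤ ∑ t ∈ Finset.Icc 1 (I.T + 1), wl1 S.w (x t - x (t - 1)) := by
    have h1 := two_mul_rise_le (fun t => S.c k * |x t k|) (τ := τ) (T := I.T + 1) (by omega)
      (by simp [hx0]) (by simp [hxT])
    have h2 := mul_le_mul_of_nonneg_left h1 S.beta_nonneg
    rw [← mul_assoc, mul_comm S.beta 2] at h2
    refine h2.trans ?_
    rw [Icc_one_eq_Ioc, Finset.mul_sum]
    refine Finset.sum_le_sum fun t _ => ?_
    refine le_trans ?_ (mul_abs_le_wl1 S.w_nonneg (x t - x (t - 1)) k)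
    have hck := S.c_pos k
    rw [← mul_sub, abs_mul, abs_of_pos hck, ← mul_assoc, S.beta_eq hk,
      div_mul_cancel₀ _ hck.ne', Pi.sub_apply]
    exact mul_le_mul_of_nonneg_left (abs_abs_sub_abs_le_abs_sub _ _) (S.w_nonneg k)
  rw [totalCost, hhit]
  linarith

end Setting

end CFL

namespace CFL

/-! ### The adversary against an online algorithm -/

/-- The input with level `l t` at time `t`. -/
noncomputable def Setting.levelInput {d : ℕ} (S : Setting d) (k : Fin d) (n T : ℕ) (l : ℕ → ℕ) : Input d :=
  ⟨T, fun t => S.levelCost k n (l t)⟩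

/-- Follow `l` up to time `τ`, and continue with `Up` forever. -/
def cutoff (l : ℕ → ℕ) (τ t : ℕ) : ℕ := if t ≤ τ then l t else 0

theorem cutoff_of_le {l : ℕ → ℕ} {τ t : ℕ} (h : t ≤ τ) : cutoff l τ t = l t := if_pos h

/-- The amount that a rule buys in direction `k` in response to levels. -/
noncomputable def Setting.response {d : ℕ} (S : Setting d) (k : Fin d) (n T : ℕ) (A : Rule d)
    (l : ℕ → ℕ) (t : ℕ) : ℝ :=
  S.c k * |A.run (S.levelInput k n T l) t k|

namespace Setting

variable {d : ℕ} {S : Setting d}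

theorem causal_response (k : Fin d) (n T : ℕ) (A : Rule d) : Causal (S.response k n T A) := by
  intro l l' t h
  have : (fun s : Fin t => (S.levelInput k n T l).f (s + 1))
      = fun s : Fin t => (S.levelInput k n T l').f (s + 1) := by
    funext s
    simp only [levelInput]
    rw [h (s + 1) s.2]
  simp only [response, Rule.run, this]
  rfl

theorem response_nonneg (k : Fin d) (n T : ℕ) (A : Rule d) (l : ℕ → ℕ) (t : ℕ) :
    0 ≤ S.response k n T A l t :=
  mul_nonneg (S.c_pos k).le (abs_nonneg _)

theorem sum_Ioc_eq_sum_range {τ : ℕ → ℕ} (h0 : τ 0 = 0) {n : ℕ}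
    (hτ : ∀ i < n, τ i ≤ τ (i + 1)) (f : ℕ → ℝ) {j : ℕ} (hj : j ≤ n) :
    ∑ t ∈ Finset.Ioc 0 (τ j), f t
      = ∑ i ∈ Finset.range j, ∑ t ∈ Finset.Ioc (τ i) (τ (i + 1)), f t := by
  induction j with
  | zero => simp [h0]
  | succ j ih =>
    rw [Finset.sum_range_succ, ← ih (by omega),
      Finset.sum_Ioc_consecutive _ (Nat.zero_le _) (hτ j (by omega))]

theorem levels_sorted {l τ : ℕ → ℕ} {n : ℕ} (h0 : τ 0 = 0)
    (hl : ∀ i < n, ∀ t ∈ Finset.Ioc (τ i) (τ (i + 1)), l t = 0 ∨ l t = i + 1) {j : ℕ}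
    (hj : j ≤ n) :
    (∀ t, 1 ≤ t → t ≤ τ j → l t ≤ j) ∧
      ∀ s t, 1 ≤ s → s ≤ t → t ≤ τ j → l s ≠ 0 → l t ≠ 0 → l s ≤ l t := by
  induction j with
  | zero => exact ⟨fun t h1 h2 => by omega, fun s t h1 h2 h3 => by omega⟩
  | succ j ih =>
    obtain ⟨ih1, ih2⟩ := ih (by omega)
    have hle : ∀ t, 1 ≤ t → t ≤ τ (j + 1) → l t ≤ j + 1 := by
      intro t h1 h2
      by_cases ht : t ≤ τ j
      · exact (ih1 t h1 ht).trans (Nat.le_succ j)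
      · rcases hl j hj t (Finset.mem_Ioc.2 ⟨by omega, h2⟩) with h | h <;> omega
    refine ⟨hle, fun s t h1 h2 h3 h4 h5 => ?_⟩
    by_cases ht : t ≤ τ j
    · exact ih2 s t h1 h2 ht h4 h5
    · rcases hl j hj t (Finset.mem_Ioc.2 ⟨by omega, h3⟩) with h | h
      · exact absurd h h5
      · rw [h]; exact hle s h1 (h2.trans h3)

theorem isYSequence_cutoff {k : Fin d} {n m j T : ℕ} {l τ : ℕ → ℕ} (h0 : τ 0 = 0)
    (hτ : ∀ i < n, τ i + m ≤ τ (i + 1))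
    (hl : ∀ i < n, ∀ t ∈ Finset.Ioc (τ i) (τ (i + 1)), l t = 0 ∨ l t = i + 1)
    (hb : ∀ i < n, ∀ t ∈ Finset.Ioc (τ (i + 1) - m) (τ (i + 1)), l t = i + 1)
    (hj : j ≤ n) (hT : τ j + m + m ≤ T) :
    S.IsYSequence k n m j (S.levelInput k n T (cutoff l (τ j))) ∧
      ∃ σ, σ + m ≤ T ∧ ∀ t ∈ Finset.Ioc σ (σ + m), cutoff l (τ j) t = j := by
  obtain ⟨hle, hmono⟩ := levels_sorted h0 hl hj
  -- For `j = 0` the subtraction truncates and the batch is the first `m` copies of `Up`; for `j >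
  -- 0` it ends at `τ j`.
  have hbatch : (∀ t ∈ Finset.Ioc (τ j - m) (τ j - m + m), cutoff l (τ j) t = j) ∧
      τ j ≤ τ j - m + m ∧ τ j - m + m ≤ τ j + m := by
    refine ⟨?_, by omega, by omega⟩
    intro t ht
    rw [Finset.mem_Ioc] at ht
    rcases Nat.eq_zero_or_pos j with rfl | hj0
    · rw [cutoff, if_neg (by omega)]
    · obtain ⟨i, rfl⟩ : ∃ i, j = i + 1 := ⟨j - 1, by omega⟩
      have := hτ i hj
      rw [cutoff, if_pos (by omega), hb i hj t (Finset.mem_Ioc.2 ⟨ht.1, by omega⟩)]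
  refine ⟨⟨cutoff l (τ j), τ j - m, fun t ht => ⟨rfl, ?_⟩, ?_, hbatch.1, ?_, ?_⟩,
    τ j - m, by omega, hbatch.1⟩
  · rw [Finset.mem_Icc] at ht
    unfold cutoff
    split_ifs with h
    · exact hle t ht.1 h
    · exact Nat.zero_le j
  · intro s hs t _ hst h1 h2
    unfold cutoff at h1 h2 ⊢
    have ht : t ≤ τ j := by by_contra h; exact h2 (if_neg h)
    rw [if_pos ht] at h2 ⊢
    rw [if_pos (hst.trans ht)] at h1 ⊢
    exact hmono s t (Finset.mem_Icc.1 hs).1 hst ht h1 h2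
  · intro t ht
    rw [Finset.mem_Ioc] at ht
    exact if_neg (by omega)
  · simp only [levelInput]; omega

theorem sum_response_le (k : Fin d) (n : ℕ) (A : Rule d) (l : ℕ → ℕ) {T τ : ℕ} (hτ : τ ≤ T) :
    ∑ t ∈ Finset.Ioc 0 τ, S.response k n T A l t
      ≤ ∑ t ∈ Finset.Icc 1 T, wl1 S.c (A.run (S.levelInput k n T l) t) := by
  rw [Icc_one_eq_Ioc]
  refine (Finset.sum_le_sum_of_subset_of_nonneg (Finset.Ioc_subset_Ioc_right hτ)
    fun t _ _ => response_nonneg k n T A l t).trans (Finset.sum_le_sum fun t _ => ?_)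
  exact mul_abs_le_wl1 (fun i => (S.c_pos i).le) _ k

/-- The algorithm pays at least the optimum of the linear program, up to a small error. -/
theorem max_sub_le_totalCost {k : Fin d} (hk : ∀ i, S.w i / S.c i ≤ S.w k / S.c k)
    {A : Rule d} {n T j : ℕ} {l τ : ℕ → ℕ} (h0 : τ 0 = 0)
    (hτ : ∀ i < n, τ i ≤ τ (i + 1)) (hj : j ≤ n) (hT : τ j ≤ T)
    (hl : ∀ i < n, ∀ t ∈ Finset.Ioc (τ i) (τ (i + 1)), l t = 0 ∨ l t = i + 1)
    {ρ η K : ℝ} (hρ0 : 0 ≤ ρ)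
    (hK : ∑ t ∈ Finset.Ioc 0 (τ j), S.response k n T A l t ≤ K)
    (hex : ∀ i < j, ∑ t ∈ Finset.Ioc (τ i) (τ (i + 1)), excess ρ (S.response k n T A) l t ≤ η)
    (hfeas : S.IsFeasible T (A.run (S.levelInput k n T (cutoff l (τ j))))) {D : ℕ → ℝ}
    (hD : ∀ i, D i = ∑ t ∈ Finset.Ioc (τ i) (τ (i + 1)),
      if l t = 0 then 0 else S.response k n T A l t) :
    max (S.U - ∑ i ∈ Finset.range j,
          ((i + 1 : ℕ) * ((S.U - S.L) / n) - 2 * S.beta) * D i)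
        (∑ i ∈ Finset.range j,
          (S.U - ((i + 1 : ℕ) * ((S.U - S.L) / n) - 2 * S.beta)) * D i)
      - 2 * S.beta * (2 * ρ * K + j * η)
    ≤ S.totalCost (S.levelInput k n T (cutoff l (τ j)))
        (A.run (S.levelInput k n T (cutoff l (τ j)))) := by
  set u := S.response k n T A with hu
  set l' := cutoff l (τ j) with hl'
  set δ := (S.U - S.L) / n with hδ
  have hag : ∀ t ≤ τ j, l' t = l t := fun t ht => if_pos ht
  have hcausal : Causal u := causal_response k n T A
  have hu0 : ∀ l t, 0 ≤ u l t := response_nonneg k n T A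
  have hut : ∀ t ≤ τ j, u l' t = u l t := fun t ht =>
    hcausal l' l t fun s hs => hag s (hs.trans ht)
  have hcost := le_totalCost hk (n := n) (τ := τ j) (l := l')
    (I := S.levelInput k n T l') (fun t _ => rfl) hT
    (fun t ht => if_neg (not_le.2 ht)) hfeas
  set C := S.totalCost (S.levelInput k n T l') (A.run (S.levelInput k n T l'))
  set Tot := ∑ t ∈ Finset.Icc 1 T, wl1 S.c (A.run (S.levelInput k n T l') t) with hTot
  have hTot1 : 1 ≤ Tot := hfeas.2.2.2
  set E := ∑ i ∈ Finset.range j, D i with hE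
  have hEsum : E = ∑ t ∈ Finset.Ioc 0 (τ j), if l t = 0 then 0 else u l t := by
    rw [sum_Ioc_eq_sum_range h0 hτ _ hj]
    exact Finset.sum_congr rfl fun i _ => hD i
  have hEle : E ≤ ∑ t ∈ Finset.Ioc 0 (τ j), u l t := by
    rw [hEsum]
    refine Finset.sum_le_sum fun t _ => ?_
    split_ifs
    · exact hu0 l t
    · exact le_rfl
  have hETot : E ≤ Tot := by
    have := sum_response_le (S := S) k n A l' hT
    rw [hcausal.sum_congr hag] at this
    exact hEle.trans this
  have hQ : ∑ t ∈ Finset.Ioc 0 (τ j), (l' t : ℝ) * u l' t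
      = ∑ i ∈ Finset.range j, (i + 1 : ℕ) * D i := by
    rw [sum_Ioc_eq_sum_range h0 hτ _ hj]
    refine Finset.sum_congr rfl fun i hi => ?_
    rw [hD, Finset.mul_sum]
    have hin : i < n := (Finset.mem_range.1 hi).trans_le hj
    have hmono : τ (i + 1) ≤ τ j := by
      have : ∀ b, i + 1 ≤ b → b ≤ j → τ (i + 1) ≤ τ b := by
        intro b hb
        induction b, hb using Nat.le_induction with
        | base => exact fun _ => le_rfl
        | succ b _ ih => exact fun hb' => (ih (by omega)).trans (hτ b (by omega))
      exact this j (Finset.mem_range.1 hi) le_rfl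
    refine Finset.sum_congr rfl fun t ht => ?_
    have htj : t ≤ τ j := (Finset.mem_Ioc.1 ht).2.trans hmono
    rw [hag t htj, hut t htj]
    rcases hl i hin t ht with h | h
    · simp [h]
    · simp [h]
  set R := ∑ t ∈ Finset.Ioc 0 (τ j), max (u l t - u l (t - 1)) 0 with hR
  have hR' : ∑ t ∈ Finset.Ioc 0 (τ j), max (u l' t - u l' (t - 1)) 0 = R := by
    refine Finset.sum_congr rfl fun t ht => ?_
    have := (Finset.mem_Ioc.1 ht).2
    rw [hut t this, hut (t - 1) (by omega)]
  have hrise : (1 - 2 * ρ) * E - R ≤ j * η := by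
    have h1 : ∑ t ∈ Finset.Ioc 0 (τ j), excess ρ u l t = (1 - 2 * ρ) * E - R := by
      simp only [excess]
      rw [Finset.sum_sub_distrib, ← Finset.mul_sum, hEsum]
    rw [← h1, sum_Ioc_eq_sum_range h0 hτ _ hj]
    refine (Finset.sum_le_card_nsmul _ _ η fun i hi => hex i (Finset.mem_range.1 hi)).trans ?_
    simp
  have hcost' : S.U * Tot - δ * ∑ i ∈ Finset.range j, (i + 1 : ℕ) * D i + 2 * S.beta * R ≤ C := by
    rw [← hQ, ← hR']
    exact hcost
  have hβ := S.beta_nonneg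
  -- The excess bounds say that rises match the `Down` purchases up to the discount, which costs at
  -- most `2 ρ K`, and `η` per level.
  have hREK : E - (2 * ρ * K + j * η) ≤ R := by
    have : ρ * E ≤ ρ * K := mul_le_mul_of_nonneg_left (hEle.trans hK) hρ0
    linarith
  have h2 := mul_le_mul_of_nonneg_left hREK (by linarith : 0 ≤ 2 * S.beta)
  have hS : ∑ i ∈ Finset.range j, ((i + 1 : ℕ) * δ - 2 * S.beta) * D i
      = δ * ∑ i ∈ Finset.range j, (i + 1 : ℕ) * D i - 2 * S.beta * E := by
    rw [hE, Finset.mul_sum, Finset.mul_sum, ← Finset.sum_sub_distrib]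
    exact Finset.sum_congr rfl fun i _ => by ring
  have hP : ∑ i ∈ Finset.range j, (S.U - ((i + 1 : ℕ) * δ - 2 * S.beta)) * D i
      = S.U * E - (δ * ∑ i ∈ Finset.range j, (i + 1 : ℕ) * D i - 2 * S.beta * E) := by
    rw [← hS, hE, Finset.mul_sum, ← Finset.sum_sub_distrib]
    exact Finset.sum_congr rfl fun i _ => by ring
  have hU1 := mul_le_mul_of_nonneg_left hTot1 S.U_pos.le
  have hU2 := mul_le_mul_of_nonneg_left hETot S.U_pos.le
  -- The two branches use `Tot ≥ 1` and `Tot ≥ E` respectively.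
  rw [sub_le_iff_le_add, hS, hP]
  refine max_le ?_ ?_ <;> linarith

/-- Against every online algorithm, and for every `q < α`, some member of the family forces a ratio
of at least `q`. -/
theorem exists_mem_yFamily_le_ratio {k : Fin d} (hk : ∀ i, S.w i / S.c i ≤ S.w k / S.c k) (N : ℕ)
    {A : Rule d} (hA : S.IsOnlineAlgorithm A) {q : ℝ} (hq : 0 < q) (hqα : q < S.alpha) :
    ∃ I ∈ S.yFamily k N, q ≤ S.totalCost I (A.run I) / S.opt I := by
  obtain ⟨r, hr0, hr1, hr2, hrα⟩ := S.exists_alpha_eq_inv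
  have hqr : q * r < 1 := by
    rw [hrα] at hqα
    calc q * r < r⁻¹ * r := mul_lt_mul_of_pos_right hqα hr0
      _ = 1 := inv_mul_cancel₀ hr0.ne'
  have hβ := S.beta_nonneg
  have hL := S.L_pos
  have hU := S.U_pos
  have hck := S.c_pos k
  obtain ⟨ε, hε, n₀, hLP⟩ :=
    exists_level_max_ge hL hr0 hβ S.two_mul_beta_lt hr1 hr2 hq hqr
  set n := max n₀ (N + 1) with hn
  have hnN : N < n := Nat.lt_of_succ_le (le_max_right _ _)
  obtain ⟨m, hm⟩ := exists_nat_ge (max (N + 1 : ℝ) (max (1 / S.c k) (q * (2 * S.beta) / (ε / 2))))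
  rw [max_le_iff, max_le_iff] at hm
  obtain ⟨hmN, hmc, hmε⟩ := hm
  have hmN' : N < m := by exact_mod_cast hmN
  have hm1 : (1 : ℝ) ≤ m := by
    have : 1 ≤ m := by omega
    exact_mod_cast this
  rw [div_le_iff₀ hck] at hmc
  have hmβ : q * (2 * S.beta / m) ≤ ε / 2 := by
    rw [div_le_iff₀ (by positivity)] at hmε
    rw [mul_div_assoc', div_le_iff₀ (by positivity)]
    linarith
  -- Buying `K` costs at least `L K`, which is `q` times an upper bound for every optimum here.
  set K := q * (S.U + 2 * S.beta) / S.L with hK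
  have hK0 : 0 < K := by positivity
  have hLK : S.L * K = q * (S.U + 2 * S.beta) := by rw [hK]; field_simp
  -- Of the margin `ε`, the optimum's switching cost uses `ε / 2`, and `ρ` and `η` use `ε / 4` each.
  set ρ := min (1 / 2) (ε / (16 * (S.beta + 1) * K)) with hρ
  have hρ0 : 0 < ρ := lt_min (by norm_num) (by positivity)
  have hρK : 2 * S.beta * (2 * ρ * K) ≤ ε / 4 := by
    have h1 : ρ ≤ ε / (16 * (S.beta + 1) * K) := min_le_right _ _
    rw [le_div_iff₀ (by positivity)] at h1
    nlinarith [mul_pos hρ0 hK0]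
  set η := ε / (8 * (S.beta + 1) * n) with hη
  have hn0 : (0 : ℝ) < n := by exact_mod_cast (by omega : 0 < n)
  have hη0 : 0 < η := by positivity
  have hηn : 2 * S.beta * (n * η) ≤ ε / 4 := by
    have h1 : η * (8 * (S.beta + 1) * n) = ε := div_mul_cancel₀ _ (by positivity)
    nlinarith [mul_pos hn0 hη0]
  obtain ⟨B, hB⟩ := exists_adversary hρ0 (min_le_left _ _) hη0 K m n
  obtain ⟨T₁, hT₁⟩ := exists_nat_ge (1 / S.c k)
  rw [div_le_iff₀ hck] at hT₁
  -- Room for the adversary, a batch (needed when `j = 0`), the `Up` tail, and the long-horizon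
  -- condition.
  set T := B + m + m + N + 1 + T₁ with hT
  obtain ⟨l, τ, h0, hadv⟩ := hB (S.response k n T A) (causal_response k n T A)
    (response_nonneg k n T A)
  have hτm : ∀ i < n, τ i + m ≤ τ (i + 1) := fun i hi => (hadv i hi).1
  have hτ : ∀ i < n, τ i ≤ τ (i + 1) := fun i hi => by have := hτm i hi; omega
  have hτB : ∀ j ≤ n, τ j ≤ B := by
    intro j hj
    rcases Nat.eq_zero_or_pos j with rfl | hj0
    · omega
    · obtain ⟨i, rfl⟩ : ∃ i, j = i + 1 := ⟨j - 1, by omega⟩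
      exact (hadv i hj).2.1
  have hl := fun i hi => (hadv i hi).2.2.1
  have hb := fun i hi => (hadv i hi).2.2.2.1
  have hTN : ∀ j' ≤ N, 1 ≤ ((T : ℝ) - (j' + 1)) * S.c k := by
    intro j' hj'
    have h1 : j' + 1 + T₁ ≤ T := by omega
    have h2 : (j' : ℝ) + 1 + T₁ ≤ T := by exact_mod_cast h1
    exact hT₁.trans (mul_le_mul_of_nonneg_right (by linarith) hck.le)
  have hmem : ∀ j ≤ n, S.levelInput k n T (cutoff l (τ j)) ∈ S.yFamily k N := by
    intro j hj
    have := hτB j hj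
    exact ⟨⟨n, m, j, hnN, hmN', hj,
      (isYSequence_cutoff h0 hτm hl hb hj (by omega)).1⟩, fun j' hj' => ⟨k, hTN j' hj'⟩⟩
  have hlev : ∀ j ≤ n, ∀ t ∈ Finset.Icc 1 (S.levelInput k n T (cutoff l (τ j))).T,
      (S.levelInput k n T (cutoff l (τ j))).f t = S.levelCost k n (cutoff l (τ j) t) ∧
        cutoff l (τ j) t ≤ n := by
    intro j hj t ht
    refine ⟨rfl, ?_⟩
    unfold cutoff
    split_ifs with h
    · exact ((levels_sorted h0 hl hj).1 t (Finset.mem_Icc.1 ht).1 h).trans hj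
    · exact Nat.zero_le n
  have hfeas : ∀ j ≤ n, S.IsFeasible T (A.run (S.levelInput k n T (cutoff l (τ j)))) :=
    fun j hj => hA _ (yFamily_subset_instances k N (hmem j hj))
  have hoptpos : ∀ j ≤ n, 0 < S.opt (S.levelInput k n T (cutoff l (τ j))) := fun j hj =>
    hL.trans_le (L_le_opt (hlev j hj) ⟨_, hfeas j hj⟩)
  have hopt : ∀ j ≤ n, S.opt (S.levelInput k n T (cutoff l (τ j)))
      ≤ S.U - j * ((S.U - S.L) / n) + 2 * S.beta / m := by
    intro j hj
    have := hτB j hj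
    obtain ⟨-, σ, hσ, hσj⟩ :=
      isYSequence_cutoff (S := S) (k := k) h0 hτm hl hb hj (by omega : τ j + m + m ≤ T)
    exact opt_le hk (hlev j hj) hσj hmc hσ
  by_cases hbig : ∃ j ≤ n, K ≤ ∑ t ∈ Finset.Ioc 0 (τ j), S.response k n T A l t
  · obtain ⟨j, hj, hKj⟩ := hbig
    refine ⟨_, hmem j hj, ?_⟩
    rw [le_div_iff₀ (hoptpos j hj)]
    have hτT : τ j ≤ T := by have := hτB j hj; omega
    have h1 := sum_response_le (S := S) k n A (cutoff l (τ j)) hτT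
    rw [(causal_response k n T A).sum_congr fun s hs => cutoff_of_le hs] at h1
    have h2 := mul_sum_le_totalCost (hlev j hj) (hfeas j hj)
    have h3 := mul_le_mul_of_nonneg_left (hKj.trans h1) hL.le
    rw [hLK] at h3
    have h4 : S.opt (S.levelInput k n T (cutoff l (τ j))) ≤ S.U + 2 * S.beta := by
      have h5 : 2 * S.beta / m ≤ 2 * S.beta := div_le_self (by positivity) hm1
      have h6 := price_le_U (S := S) n j
      linarith [hopt j hj]
    exact (mul_le_mul_of_nonneg_left h4 hq.le).trans (h3.trans h2)
  · push Not at hbig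
    set D : ℕ → ℝ := fun i => ∑ t ∈ Finset.Ioc (τ i) (τ (i + 1)),
      if l t = 0 then 0 else S.response k n T A l t with hD
    obtain ⟨j, hj, hLPj⟩ := hLP n (le_max_left _ _) (by omega) D fun i =>
      Finset.sum_nonneg fun t _ => by
        split_ifs
        · exact le_rfl
        · exact response_nonneg k n T A l t
    refine ⟨_, hmem j hj, ?_⟩
    rw [le_div_iff₀ (hoptpos j hj)]
    have hcost := max_sub_le_totalCost hk h0 hτ hj (by have := hτB j hj; omega : τ j ≤ T) hl
      hρ0.le (hbig j hj).le
      (fun i hi => (hadv i (by omega)).2.2.2.2.resolve_left (not_le.2 (hbig (i + 1) (by omega))))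
      (hfeas j hj) (fun i => rfl : ∀ i, D i = _)
    have h1 := mul_le_mul_of_nonneg_left (hopt j hj) hq.le
    have h2 : 2 * S.beta * (j * η) ≤ 2 * S.beta * (n * η) := by
      have : (j : ℝ) ≤ n := by exact_mod_cast hj
      gcongr
    rw [mul_add] at h1 hcost
    linarith

end Setting

end CFL

/-! ### Passing to the supremum -/

theorem theorem3p4 {d : ℕ} (S : CFL.Setting d) (k : Fin d)
    (hk : ∀ i, S.w i / S.c i ≤ S.w k / S.c k) (N : ℕ) :
    S.yFamily k N ⊆ S.instances ∧
      ∀ A : CFL.Rule d, S.IsOnlineAlgorithm A →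
        (S.alpha : EReal) ≤ S.compRatio A (S.yFamily k N) := by
  refine ⟨CFL.Setting.yFamily_subset_instances k N, fun A hA => ?_⟩
  by_contra! h
  obtain ⟨q, hq1, hq2⟩ := EReal.lt_iff_exists_real_btwn.1 h
  rw [EReal.coe_lt_coe_iff] at hq2
  obtain ⟨r, hr0, -, -, hrα⟩ := S.exists_alpha_eq_inv
  have hα : 0 < S.alpha := hrα ▸ inv_pos.2 hr0
  -- The separating `q` may be nonpositive, so it is replaced by its maximum with `α / 2`.
  obtain ⟨I, hI, hle⟩ := CFL.Setting.exists_mem_yFamily_le_ratio hk N hA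
    (lt_max_of_lt_right (half_pos hα)) (max_lt hq2 (half_lt_self hα))
  have h1 : ((S.totalCost I (A.run I) / S.opt I : ℝ) : EReal) ≤ S.compRatio A (S.yFamily k N) :=
    le_iSup₂ (f := fun I (_ : I ∈ S.yFamily k N) =>
      ((S.totalCost I (A.run I) / S.opt I : ℝ) : EReal)) I hI
  have h2 : (q : EReal) ≤ ((S.totalCost I (A.run I) / S.opt I : ℝ) : EReal) :=
    EReal.coe_le_coe_iff.2 ((le_max_left _ _).trans hle)
  exact absurd (h2.trans h1) (not_le.2 hq1)
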